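/- **Loop property of the harmonic flow on $T^2$.** Let $T^2=\mathbb R^2/\mathbb Z^2$ carry the symplectic form $\omega=dx\wedge dy$ and the flat metric $dx^2+dy^2$. For a smooth symplectic isotopy $\Phi=\{\phi_t\}_{t\in[0,1]}$ of $(T^2,\omega)$ with $\phi_0=\mathrm{Id}$ and generating vector field $X_t=\dot\phi_t\circ\phi_t^{-1}$, the flux form is $\Sigma(\Phi)=\int_0^1\phi_t^*(\iota_{X_t}\omega)\,dt$, and its de Rham class $\mathrm{Flux}(\Phi)=[\Sigma(\Phi)]\in H^1(T^2;\mathbb R)$ is the flux of $\Phi$. The flux group $\Gamma_\omega\subset H^1(T^2;\mathbb R)$ is the set of fluxes of all smooth symplectic loops at the identity ($\phi_0=\phi_1=\mathrm{Id}$). A vector field $A$ is called harmonic if $\iota_A\omega$ is a harmonic $1$-form. Let $\Phi$ be a smooth symplectic loop at the identity. Then: 1. The map $\mathbb Z^2\to H^1(T^2;\mathbb R)$, $(m,n)\mapsto m[dx]+n[dy]$, is an injective homomorphism with image $\Gamma_\omega$; thus $\Gamma_\omega\cong\mathbb Z^2$. 2. The flux form $\Sigma(\Phi)$ is smooth and closed,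 and the class $\mathrm{Flux}(\Phi)$ has a unique harmonic representative $\alpha$. There is a unique harmonic vector field $A$ with $\iota_A\omega=\alpha$; it is constant, and it has a unique flow $\{\psi_t\}_{t\in\mathbb R}$ ($\psi_0=\mathrm{Id}$, $\dot\psi_t=A\circ\psi_t$). 3. $\psi_1=\mathrm{Id}$ if and only if $\mathrm{Flux}(\Phi)\in\Gamma_\omega$. -/

import Mathlib

open scoped ContDiff Topology

noncomputable section

namespace TorusFlux

/-! ### The torus, its smooth structure and its tangent spaces -/

/-- The torus `ℝ² / ℤ²`. -/
abbrev Torus : Type := UnitAddCircle × UnitAddCircle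

/-- The covering projection `ℝ² → ℝ² / ℤ²`. -/
def proj (x : ℝ × ℝ) : Torus := ((x.1 : UnitAddCircle), (x.2 : UnitAddCircle))

/-- The representative of a point of the torus in the square `(-1/2, 1/2]²`. Near `0` this is the
inverse of `proj`, and `z ↦ coords (z - q)` is the standard flat chart of the torus centred at `q`.
Transition maps between these charts are locally translations, so the frame `∂/∂x, ∂/∂y`
is global and every tangent space of the torus is identified with `ℝ × ℝ` by means of it. -/
def coords (q : Torus) : ℝ × ℝ :=
  ((AddCircle.equivIoc (1 : ℝ) (-1 / 2) q.1 : ℝ), (AddCircle.equivIoc (1 : ℝ) (-1 / 2) q.2 : ℝ))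

theorem proj_coords (q : Torus) : proj (coords q) = q :=
  Prod.ext ((AddCircle.equivIoc (1 : ℝ) (-1 / 2)).symm_apply_apply q.1)
    ((AddCircle.equivIoc (1 : ℝ) (-1 / 2)).symm_apply_apply q.2)

/-- A function on the torus with values in a normed space is smooth if its `ℤ²`-periodic
pullback to `ℝ²` is smooth. -/
def SmoothFun {F : Type*} [NormedAddCommGroup F] [NormedSpace ℝ F] (f : Torus → F) : Prop :=
  ContDiff ℝ ∞ (fun x : ℝ × ℝ => f (proj x))

/-- A map into the torus, defined on a subset `S` of a normed space, is smooth on `S` if near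
every point of `S` it lifts along `proj` to a smooth map into `ℝ²`. -/
def SmoothIntoOn {X : Type*} [NormedAddCommGroup X] [NormedSpace ℝ X] (F : X → Torus)
    (S : Set X) : Prop :=
  ∀ x ∈ S, ∃ U : Set X, IsOpen U ∧ x ∈ U ∧
    ∃ g : X → ℝ × ℝ, ContDiffOn ℝ ∞ g (S ∩ U) ∧ ∀ y ∈ S ∩ U, proj (g y) = F y

/-- A self-map of the torus is smooth if it is so after composition with the covering. -/
def SmoothMap (F : Torus → Torus) : Prop :=
  SmoothIntoOn (fun x : ℝ × ℝ => F (proj x)) Set.univ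

/-- The differential `T_p T² → T_{F p} T²` of a self-map `F` of the torus, computed in the flat
charts centred at `p` and at `F p`. -/
def tangentMap (F : Torus → Torus) (p : Torus) : ℝ × ℝ →L[ℝ] ℝ × ℝ :=
  fderiv ℝ (fun v : ℝ × ℝ => coords (F (p + proj v) - F p)) 0

/-! ### Differential forms and de Rham cohomology in degree one -/

/-- One-forms on the torus (not necessarily smooth), written in the global frame. -/
def OneForm : Type := Torus → (ℝ × ℝ →L[ℝ] ℝ)

instance : AddCommGroup OneForm := inferInstanceAs (AddCommGroup (Torus → (ℝ × ℝ →L[ℝ] ℝ)))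

instance : Module ℝ OneForm := inferInstanceAs (Module ℝ (Torus → (ℝ × ℝ →L[ℝ] ℝ)))

/-- Vector fields on the torus, written in the global frame `∂/∂x, ∂/∂y`. -/
abbrev VField : Type := Torus → ℝ × ℝ

/-- The form `dx`. -/
def dx : OneForm := fun _ => ContinuousLinearMap.fst ℝ ℝ ℝ

/-- The form `dy`. -/
def dy : OneForm := fun _ => ContinuousLinearMap.snd ℝ ℝ ℝ

/-- The standard symplectic form `ω = dx ∧ dy` (at every point),
`ω (u, v) = u.1 * v.2 - u.2 * v.1`. -/
def omega : ℝ × ℝ →L[ℝ] ℝ × ℝ →L[ℝ] ℝ :=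
  (ContinuousLinearMap.fst ℝ ℝ ℝ).smulRight (ContinuousLinearMap.snd ℝ ℝ ℝ) -
    (ContinuousLinearMap.snd ℝ ℝ ℝ).smulRight (ContinuousLinearMap.fst ℝ ℝ ℝ)

theorem omega_apply (u v : ℝ × ℝ) : omega u v = u.1 * v.2 - u.2 * v.1 := by
  simp [omega]

/-- The contraction `ι_X ω`. -/
def contract (X : VField) : OneForm := fun p => omega (X p)

/-- The derivative of a one-form in the flat coordinates, at the point `proj x`:
`formDeriv α x u v = D_u (α v)`. -/
def formDeriv (α : OneForm) (x : ℝ × ℝ) : ℝ × ℝ →L[ℝ] ℝ × ℝ →L[ℝ] ℝ :=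
  fderiv ℝ (fun y : ℝ × ℝ => α (proj y)) x

/-- Smooth closed one-forms: `dα (u, v) = D_u (α v) - D_v (α u) = 0`. -/
def closedForms : Submodule ℝ OneForm where
  carrier := {α | SmoothFun α ∧ ∀ x u v, formDeriv α x u v - formDeriv α x v u = 0}
  zero_mem' := by
    refine ⟨contDiff_const, fun x u v => ?_⟩
    have h : formDeriv 0 x = 0 := fderiv_const_apply (0 : ℝ × ℝ →L[ℝ] ℝ)
    simp [h]
  add_mem' := by
    rintro α β ⟨hα, hα'⟩ ⟨hβ, hβ'⟩
    refine ⟨ContDiff.add hα hβ, fun x u v => ?_⟩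
    have h : formDeriv (α + β) x = formDeriv α x + formDeriv β x :=
      fderiv_add (hα.differentiable (by simp) x) (hβ.differentiable (by simp) x)
    have h1 := hα' x u v
    have h2 := hβ' x u v
    simp only [h, add_apply]
    linarith
  smul_mem' := by
    rintro c α ⟨hα, hα'⟩
    refine ⟨ContDiff.const_smul c hα, fun x u v => ?_⟩
    have h : formDeriv (c • α) x = c • formDeriv α x :=
      fderiv_const_smul (hα.differentiable (by simp) x) c
    simp only [h, smul_apply, smul_eq_mul]
    rw [← mul_sub, hα' x u v, mul_zero]

/-- Exact one-forms: the differentials `df` of smooth functions on the torus. -/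
def exactForms : Submodule ℝ OneForm where
  carrier := {α | ∃ f : Torus → ℝ, SmoothFun f ∧
    ∀ x : ℝ × ℝ, α (proj x) = fderiv ℝ (fun y : ℝ × ℝ => f (proj y)) x}
  zero_mem' := ⟨fun _ => 0, contDiff_const, fun _ => (fderiv_const_apply (0 : ℝ)).symm⟩
  add_mem' := by
    rintro α β ⟨f, hf, hf'⟩ ⟨g, hg, hg'⟩
    refine ⟨f + g, ContDiff.add hf hg, fun x => ?_⟩
    change α (proj x) + β (proj x) = _
    rw [hf' x, hg' x]
    exact (fderiv_add (hf.differentiable (by simp) x) (hg.differentiable (by simp) x)).symm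
  smul_mem' := by
    rintro c α ⟨f, hf, hf'⟩
    refine ⟨c • f, ContDiff.const_smul c hf, fun x => ?_⟩
    change c • α (proj x) = _
    rw [hf' x]
    exact (fderiv_const_smul (hf.differentiable (by simp) x) c).symm

/-- The de Rham cohomology `H¹(T²; ℝ)`: closed one-forms modulo exact one-forms. -/
abbrev H1 : Type := closedForms ⧸ exactForms.submoduleOf closedForms

/-- The cohomology class of a closed one-form. -/
def deRhamClass (α : OneForm) (h : α ∈ closedForms) : H1 :=
  Submodule.Quotient.mk ⟨α, h⟩

theorem dx_mem : dx ∈ closedForms :=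
  ⟨contDiff_const, fun x u v => by simp [formDeriv, dx]⟩

theorem dy_mem : dy ∈ closedForms :=
  ⟨contDiff_const, fun x u v => by simp [formDeriv, dy]⟩

/-- The homomorphism `ℤ² → H¹(T²; ℝ)`, `(m, n) ↦ m [dx] + n [dy]`. -/
def integralClass : ℤ × ℤ →+ H1 where
  toFun k := k.1 • deRhamClass dx dx_mem + k.2 • deRhamClass dy dy_mem
  map_zero' := by simp
  map_add' k l := by
    simp only [Prod.fst_add, Prod.snd_add, add_zsmul]
    abel

/-- The codifferential of a one-form `a dx + b dy` for the flat metric `dx² + dy²`, that is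
`-(∂a/∂x + ∂b/∂y)`, at the point `proj x`. -/
def codifferential (α : OneForm) (x : ℝ × ℝ) : ℝ :=
  -(formDeriv α x (1, 0) (1, 0) + formDeriv α x (0, 1) (0, 1))

/-- Harmonic one-forms for the flat metric: smooth, closed and co-closed. -/
def IsHarmonic (α : OneForm) : Prop :=
  α ∈ closedForms ∧ ∀ x, codifferential α x = 0

/-- `α` is a harmonic representative of the class `c`. -/
def IsHarmonicRep (α : OneForm) (c : H1) : Prop :=
  IsHarmonic α ∧ ∃ h : α ∈ closedForms, deRhamClass α h = c

/-- Harmonic vector fields: those whose contraction with `ω` is a harmonic one-form. -/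
def IsHarmonicField (A : VField) : Prop := IsHarmonic (contract A)

/-! ### Symplectic isotopies and flux -/

/-- A smooth symplectic isotopy `{φ_t}`, `t ∈ [0, 1]`, of `(T², dx ∧ dy)` starting at the identity.
The parameter is a real number for convenience; only the values `t ∈ [0, 1]` are ever used. -/
structure SymplecticIsotopy where
  /-- the maps `φ_t` -/
  map : ℝ → Torus ≃ Torus
  /-- `(t, p) ↦ φ_t p` is smooth on `[0, 1] × T²` -/
  smooth : SmoothIntoOn (fun z : ℝ × (ℝ × ℝ) => map z.1 (proj z.2))
    (Set.Icc (0 : ℝ) 1 ×ˢ Set.univ)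
  /-- the inverse of each `φ_t` is smooth -/
  smooth_symm : ∀ t ∈ Set.Icc (0 : ℝ) 1, SmoothMap (map t).symm
  /-- `φ_t^* ω = ω` -/
  symplectic : ∀ t ∈ Set.Icc (0 : ℝ) 1, ∀ (p : Torus) (u v : ℝ × ℝ),
    omega (tangentMap (map t) p u) (tangentMap (map t) p v) = omega u v
  /-- `φ_0 = id` -/
  map_zero : map 0 = Equiv.refl Torus

namespace SymplecticIsotopy

/-- A loop at the identity: `φ_1 = id` (and `φ_0 = id`). -/
def IsLoop (Φ : SymplecticIsotopy) : Prop := Φ.map 1 = Equiv.refl Torus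

/-- The velocity `d/dt φ_t (p)` (one-sided at the ends of `[0, 1]`), a tangent vector at `φ_t p`,
computed in the flat chart centred at `φ_t p`. -/
def velocity (Φ : SymplecticIsotopy) (t : ℝ) (p : Torus) : ℝ × ℝ :=
  derivWithin (fun s : ℝ => coords (Φ.map s p - Φ.map t p)) (Set.Icc 0 1) t

/-- The generating vector field `X_t`, with `X_t = (d/dt φ_t) ∘ φ_t⁻¹`. -/
def generator (Φ : SymplecticIsotopy) (t : ℝ) : VField :=
  fun q => Φ.velocity t ((Φ.map t).symm q)

/-- The pullback `F^* α` of a one-form. -/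
def _root_.TorusFlux.pullback (F : Torus → Torus) (α : OneForm) : OneForm :=
  fun p => (α (F p)).comp (tangentMap F p)

/-- The flux form `Σ(Φ) = ∫₀¹ φ_t^* (ι_{X_t} ω) dt`. -/
def fluxForm (Φ : SymplecticIsotopy) : OneForm :=
  fun p => ∫ t in (0 : ℝ)..1, pullback (Φ.map t) (contract (Φ.generator t)) p

open Classical in
/-- The flux of `Φ`: the cohomology class of its flux form. The flux form of a symplectic
isotopy is always closed, so the default value `0` is never used. -/
def flux (Φ : SymplecticIsotopy) : H1 :=
  if h : Φ.fluxForm ∈ closedForms then deRhamClass Φ.fluxForm h else 0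

end SymplecticIsotopy

/-- The flux group `Γ_ω`: the fluxes of all smooth symplectic loops at the identity. -/
def fluxGroup : Set H1 := {c | ∃ Φ : SymplecticIsotopy, Φ.IsLoop ∧ Φ.flux = c}

/-- `ψ` is the flow of the vector field `A`: `ψ_0 = id` and `d/dt ψ_t (p) = A (ψ_t p)`, the
derivative being computed in the flat chart centred at `ψ_t p`. -/
def IsFlow (A : VField) (ψ : ℝ → Torus → Torus) : Prop :=
  (∀ p, ψ 0 p = p) ∧
    ∀ t p, HasDerivAt (fun s : ℝ => coords (ψ s p - ψ t p)) (A (ψ t p)) t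

end TorusFlux

end

/-!
An isotopy lifts to `L : [0, 1] × ℝ² → ℝ²` with `L_0 = id`. Its flux form integrates the `dt`
component of `L^* ω` over time, and `ω = dλ` for the Liouville form `λ = (x dy - y dx) / 2`, so the
homotopy formula gives `Σ(Φ) = L_1^* λ - λ - dS` with `S` the action of the trajectories of `L`.
This form is closed because `L_1` preserves `ω`. For a loop, `L_1` is the translation by a lattice
vector `c`, and comparing periods gives `Flux(Φ) = [ι_c ω]`; translation loops realize every `c`.

Periods identify `H¹(T²; ℝ)` with the constant forms `ι_v ω`. A harmonic form `a dx + b dy` makes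
`a - i b` a bounded entire function, hence is constant by Liouville's theorem. The harmonic field
of the class `[ι_v ω]` is therefore `v`, whose time-one map is the translation by `v`; it is the
identity exactly when `v` lies in the lattice, that is, when `[ι_v ω]` is in the flux group.
-/

noncomputable section

namespace TorusFlux

/-! ### Families of maps over a time interval -/

section Strip

variable {E F : Type*} [NormedAddCommGroup E] [NormedAddCommGroup F] {a b t : ℝ} {f : ℝ × E → F}

/-- The domain `[a, b] × E` of a family of maps on `E` over a time interval. Derivatives on it are
taken with `fderivWithin`, hence are one-sided in time at `a` and `b`. -/
abbrev strip (a b : ℝ) (E : Type*) : Set (ℝ × E) := Set.Icc a b ×ˢ Set.univ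

theorem strip_subset_closure_interior (hab : a < b) :
    strip a b E ⊆ closure (interior (strip a b E)) := by
  rw [interior_prod_eq, interior_Icc, interior_univ, closure_prod_eq, closure_Ioo hab.ne,
    closure_univ]

theorem continuousOn_time_slice (hf : ContinuousOn f (strip a b E)) (x : E) :
    ContinuousOn (fun s => f (s, x)) (Set.Icc a b) :=
  hf.comp (Continuous.prodMk_left x).continuousOn fun _ hs => ⟨hs, trivial⟩

theorem intervalIntegrable_time_slice (hf : ContinuousOn f (strip a b E)) (hab : a ≤ b) (x : E) :
    IntervalIntegrable (fun s => f (s, x)) MeasureTheory.volume a b :=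
  (continuousOn_time_slice hf x).intervalIntegrable_of_Icc hab

variable [NormedSpace ℝ F]

theorem continuous_integral_of_continuousOn_strip (hab : a ≤ b)
    (hf : ContinuousOn f (strip a b E)) : Continuous fun x => ∫ t in a..b, f (t, x) := by
  have h_clamp : Continuous fun z : E × ℝ => f (Set.projIcc a b hab z.2, z.1) :=
    hf.comp_continuous (by fun_prop) fun z => ⟨(Set.projIcc a b hab z.2).2, trivial⟩
  refine (intervalIntegral.continuous_parametric_intervalIntegral_of_continuous'
    (f := fun x t => f (Set.projIcc a b hab t, x)) h_clamp a b).congr fun x =>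
      intervalIntegral.integral_congr fun t ht => ?_
  rw [Set.uIcc_of_le hab] at ht
  simp only [Set.projIcc_of_mem hab ht]

variable [NormedSpace ℝ E]

theorem uniqueDiffOn_strip (hab : a < b) : UniqueDiffOn ℝ (strip a b E) :=
  (uniqueDiffOn_Icc hab).prod uniqueDiffOn_univ

theorem hasDerivWithinAt_time_slice (hf : DifferentiableOn ℝ f (strip a b E))
    (ht : t ∈ Set.Icc a b) (x : E) :
    HasDerivWithinAt (fun s => f (s, x)) (fderivWithin ℝ f (strip a b E) (t, x) (1, 0))
      (Set.Icc a b) t :=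
  (hf (t, x) ⟨ht, trivial⟩).hasFDerivWithinAt.comp_hasDerivWithinAt (f := fun s => (s, x)) t
    ((hasDerivAt_id t).prodMk (hasDerivAt_const t x)).hasDerivWithinAt
    fun _ hs => Set.mk_mem_prod hs trivial

theorem integral_fderivWithin_time [CompleteSpace F] (hab : a < b)
    (hf : ContDiffOn ℝ 1 f (strip a b E)) (x : E) :
    ∫ t in a..b, fderivWithin ℝ f (strip a b E) (t, x) (1, 0) = f (b, x) - f (a, x) := by
  have h_cont : ContinuousOn (fun z => fderivWithin ℝ f (strip a b E) z (1, 0)) (strip a b E) :=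
    (hf.continuousOn_fderivWithin (uniqueDiffOn_strip hab) le_rfl).clm_apply continuousOn_const
  exact intervalIntegral.integral_eq_sub_of_hasDerivAt_of_le hab.le
    (continuousOn_time_slice hf.continuousOn x)
    (fun t ht => (hasDerivWithinAt_time_slice (hf.differentiableOn one_ne_zero)
      (Set.Ioo_subset_Icc_self ht) x).hasDerivAt (Icc_mem_nhds ht.1 ht.2))
    (intervalIntegrable_time_slice h_cont hab.le x)

theorem hasFDerivAt_space_slice (hf : DifferentiableOn ℝ f (strip a b E))
    (ht : t ∈ Set.Icc a b) (x : E) :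
    HasFDerivAt (fun y => f (t, y))
      ((fderivWithin ℝ f (strip a b E) (t, x)).comp (ContinuousLinearMap.inr ℝ ℝ E)) x :=
  hasFDerivWithinAt_univ.1 <| (hf (t, x) ⟨ht, trivial⟩).hasFDerivWithinAt.comp x
    (hasFDerivAt_prodMk_right t x).hasFDerivWithinAt fun _ _ => ⟨ht, trivial⟩

theorem contDiff_space_slice {n : WithTop ℕ∞} (hf : ContDiffOn ℝ n f (strip a b E))
    (ht : t ∈ Set.Icc a b) : ContDiff ℝ n fun y => f (t, y) :=
  contDiffOn_univ.1 <| hf.comp (contDiff_prodMk_right t).contDiffOn fun _ _ => ⟨ht, trivial⟩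

variable [FiniteDimensional ℝ E]

theorem hasFDerivAt_integral_of_contDiffOn_strip (hab : a < b)
    (hf : ContDiffOn ℝ 1 f (strip a b E)) (x : E) :
    HasFDerivAt (fun y => ∫ t in a..b, f (t, y))
      (∫ t in a..b, (fderivWithin ℝ f (strip a b E) (t, x)).comp
        (ContinuousLinearMap.inr ℝ ℝ E)) x := by
  have h_mem : ∀ {t}, t ∈ Set.uIoc a b → t ∈ Set.Icc a b := fun ht =>
    Set.Ioc_subset_Icc_self (Set.uIoc_of_le hab.le ▸ ht)
  have hf' : ContinuousOn (fun z => (fderivWithin ℝ f (strip a b E) z).comp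
      (ContinuousLinearMap.inr ℝ ℝ E)) (strip a b E) :=
    (hf.continuousOn_fderivWithin (uniqueDiffOn_strip hab) le_rfl).clm_comp continuousOn_const
  obtain ⟨C, hC⟩ := (isCompact_Icc.prod (isCompact_closedBall x 1)).exists_bound_of_continuousOn
    (hf'.mono (Set.prod_mono_right (Set.subset_univ _)))
  refine intervalIntegral.hasFDerivAt_integral_of_dominated_of_fderiv_le
    (bound := fun _ => C) (Metric.ball_mem_nhds x one_pos) (.of_forall fun y => ?_)
    (intervalIntegrable_time_slice hf.continuousOn hab.le x)
    (intervalIntegrable_time_slice hf' hab.le x).aestronglyMeasurable_restrict_uIoc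
    (.of_forall fun t ht y hy => hC (t, y) ⟨h_mem ht, Metric.ball_subset_closedBall hy⟩)
    intervalIntegrable_const
    (.of_forall fun t ht y _ =>
      hasFDerivAt_space_slice (hf.differentiableOn one_ne_zero) (h_mem ht) y)
  exact (intervalIntegrable_time_slice hf.continuousOn hab.le
    y).aestronglyMeasurable_restrict_uIoc

end Strip

section StripSmooth

universe u

variable {E F : Type u} [NormedAddCommGroup E] [NormedSpace ℝ E] [FiniteDimensional ℝ E]
  [NormedAddCommGroup F] [NormedSpace ℝ F] {a b : ℝ} {f : ℝ × E → F}

theorem contDiff_nat_integral_of_contDiffOn_strip (hab : a < b) (n : ℕ)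
    (hf : ContDiffOn ℝ n f (strip a b E)) : ContDiff ℝ n fun x => ∫ t in a..b, f (t, x) := by
  induction n generalizing F with
  | zero =>
    rw [Nat.cast_zero, contDiff_zero]
    exact continuous_integral_of_continuousOn_strip hab.le hf.continuousOn
  | succ n ih =>
    rw [Nat.cast_succ] at hf ⊢
    exact contDiff_succ_iff_hasFDerivAt.2 ⟨_,
      ih ((hf.fderivWithin (uniqueDiffOn_strip hab) le_rfl).clm_comp contDiffOn_const),
      hasFDerivAt_integral_of_contDiffOn_strip hab (hf.of_le (by simp))⟩

theorem contDiff_integral_of_contDiffOn_strip (hab : a < b)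
    (hf : ContDiffOn ℝ ∞ f (strip a b E)) : ContDiff ℝ ∞ fun x => ∫ t in a..b, f (t, x) :=
  contDiff_infty.2 fun n => contDiff_nat_integral_of_contDiffOn_strip hab n
    (contDiffOn_infty.1 hf n)

end StripSmooth

/-! ### The covering `ℝ² → T²` -/

theorem proj_add (x y : ℝ × ℝ) : proj (x + y) = proj x + proj y := rfl

theorem proj_sub (x y : ℝ × ℝ) : proj (x - y) = proj x - proj y := rfl

theorem proj_zero : proj 0 = 0 := rfl

/-- The inclusion `ℤ² → ℝ²` of the lattice of deck transformations of `proj`. -/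
def lattice (k : ℤ × ℤ) : ℝ × ℝ := (k.1, k.2)

theorem lattice_injective : Function.Injective lattice := fun _ _ h =>
  Prod.ext (Int.cast_injective (congrArg Prod.fst h)) (Int.cast_injective (congrArg Prod.snd h))

theorem proj_eq_zero_iff {x : ℝ × ℝ} : proj x = 0 ↔ ∃ k, lattice k = x := by
  have coe_eq_zero_iff (r : ℝ) : (r : UnitAddCircle) = 0 ↔ ∃ n : ℤ, (n : ℝ) = r := by
    simp [AddSubgroup.mem_zmultiples_iff]
  simp [Prod.ext_iff, proj, lattice, coe_eq_zero_iff]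

theorem proj_lattice (k : ℤ × ℤ) : proj (lattice k) = 0 :=
  proj_eq_zero_iff.2 ⟨k, rfl⟩

theorem proj_add_lattice (x : ℝ × ℝ) (k : ℤ × ℤ) : proj (x + lattice k) = proj x := by
  rw [proj_add, proj_lattice, add_zero]

theorem proj_surjective : Function.Surjective proj := fun q => ⟨coords q, proj_coords q⟩

theorem norm_proj_le (x : ℝ × ℝ) : ‖proj x‖ ≤ ‖x‖ := by
  have norm_coe_le (r : ℝ) : ‖(r : UnitAddCircle)‖ ≤ ‖r‖ := by
    rw [UnitAddCircle.norm_eq, Real.norm_eq_abs]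
    simpa using round_le r 0
  exact max_le_max (norm_coe_le x.1) (norm_coe_le x.2)

theorem coords_proj {x : ℝ × ℝ} (hx : ‖x‖ < 1 / 2) : coords (proj x) = x := by
  have equivIoc_coe (r : ℝ) (hr : ‖r‖ ≤ ‖x‖) :
      ((AddCircle.equivIoc (1 : ℝ) (-1 / 2) (r : UnitAddCircle) : Set.Ioc _ _) : ℝ) = r := by
    have := abs_lt.1 (hr.trans_lt hx)
    exact AddCircle.equivIoc_coe_of_mem (p := (1 : ℝ)) (a := -1 / 2)
      ⟨by linarith [this.1], by linarith [this.2]⟩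
  exact Prod.ext (equivIoc_coe _ (norm_fst_le x)) (equivIoc_coe _ (norm_snd_le x))

theorem coords_zero : coords 0 = 0 := by
  rw [← proj_zero, coords_proj (by simp)]

theorem eventually_coords_proj : ∀ᶠ x : ℝ × ℝ in 𝓝 0, coords (proj x) = x := by
  filter_upwards [Metric.ball_mem_nhds (0 : ℝ × ℝ) (by norm_num : (0 : ℝ) < 1 / 2)] with x hx
  exact coords_proj (by simpa using hx)

/-- The covering projection as a group homomorphism. -/
def projHom : ℝ × ℝ →+ Torus :=
  (QuotientAddGroup.mk' (AddSubgroup.zmultiples (1 : ℝ))).prodMap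
    (QuotientAddGroup.mk' (AddSubgroup.zmultiples (1 : ℝ)))

theorem isQuotientMap_proj : Topology.IsQuotientMap proj :=
  ((QuotientAddGroup.isOpenQuotientMap_mk (N := AddSubgroup.zmultiples (1 : ℝ))).prodMap
    QuotientAddGroup.isOpenQuotientMap_mk).isQuotientMap

theorem isDiscrete_ker_projHom : IsDiscrete (projHom.ker : Set (ℝ × ℝ)) := by
  refine .of_nhdsWithin fun x hx => Filter.le_pure_iff.2 ?_
  have h_sub : Filter.Tendsto (fun y => y - x) (𝓝[projHom.ker] x) (𝓝 0) := by
    rw [← sub_self x]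
    exact (continuous_sub_right x).continuousWithinAt
  filter_upwards [h_sub.eventually eventually_coords_proj, self_mem_nhdsWithin] with y h_coords hy
  have h_proj : proj (y - x) = 0 := sub_mem hy hx
  rwa [h_proj, coords_zero, eq_comm, sub_eq_zero] at h_coords

theorem isCoveringMap_proj : IsCoveringMap proj :=
  (Topology.IsQuotientMap.isAddQuotientCoveringMap_of_isDiscrete_ker_addMonoidHom
    (f := projHom) isQuotientMap_proj isDiscrete_ker_projHom).isCoveringMap

theorem exists_eq_add_lattice_of_proj_eq {X : Type*} [TopologicalSpace X] [PreconnectedSpace X]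
    [Nonempty X] {f g : X → ℝ × ℝ} (hf : Continuous f) (hg : Continuous g)
    (h : ∀ x, proj (f x) = proj (g x)) : ∃ k, ∀ x, f x = g x + lattice k := by
  obtain ⟨x₀⟩ := ‹Nonempty X›
  have h_sub (x : X) : proj (f x - g x) = 0 := by rw [proj_sub, h, sub_self]
  obtain ⟨k, hk⟩ := proj_eq_zero_iff.1 (h_sub x₀)
  have h_const (x : X) : f x - g x = f x₀ - g x₀ :=
    isCoveringMap_proj.const_of_comp (hf.sub hg) (fun a b => (h_sub a).trans (h_sub b).symm) x x₀
  exact ⟨k, fun x => by rw [hk, ← h_const x, add_sub_cancel]⟩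

/-! ### Calculus through the covering -/

theorem contDiffOn_of_smoothIntoOn {X : Type*} [NormedAddCommGroup X] [NormedSpace ℝ X]
    {F : X → Torus} {S : Set X} (hF : SmoothIntoOn F S) {g : X → ℝ × ℝ} (hg : ContinuousOn g S)
    (hgF : ∀ y ∈ S, proj (g y) = F y) : ContDiffOn ℝ ∞ g S := by
  intro x hx
  obtain ⟨U, hU, hxU, g', hg', hg'F⟩ := hF x hx
  have hU_mem : U ∈ 𝓝[S] x := mem_nhdsWithin_of_mem_nhds (hU.mem_nhds hxU)
  have hg'x : ContDiffWithinAt ℝ ∞ g' S x :=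
    (hg' x ⟨hx, hxU⟩).mono_of_mem_nhdsWithin (Filter.inter_mem self_mem_nhdsWithin hU_mem)
  -- Two continuous lifts of `F` differ by a locally constant lattice vector.
  have h_tendsto : Filter.Tendsto (fun y => g y - g' y - (g x - g' x)) (𝓝[S] x) (𝓝 0) := by
    simpa using ((hg x hx).sub hg'x.continuousWithinAt).tendsto.sub_const (g x - g' x)
  have h_const : g =ᶠ[𝓝[S] x] fun y => g' y + (g x - g' x) := by
    filter_upwards [h_tendsto.eventually eventually_coords_proj, self_mem_nhdsWithin, hU_mem]
      with y h_coords hy hyU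
    have h_proj : proj (g y - g' y - (g x - g' x)) = 0 := by
      simp only [proj_sub, hgF y hy, hgF x hx, hg'F y ⟨hy, hyU⟩, hg'F x ⟨hx, hxU⟩, sub_self]
    rw [h_proj, coords_zero, eq_comm, sub_eq_zero] at h_coords
    rw [← h_coords, add_sub_cancel]
  exact (hg'x.add contDiffWithinAt_const).congr_of_eventuallyEq h_const (by simp)

theorem tangentMap_proj {F : Torus → Torus} {g : ℝ × ℝ → ℝ × ℝ} {x : ℝ × ℝ}
    {g' : ℝ × ℝ →L[ℝ] ℝ × ℝ} (hg : HasFDerivAt g g' x) (hF : ∀ y, F (proj y) = proj (g y)) :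
    tangentMap F (proj x) = g' := by
  have h_shift : HasFDerivAt (fun v => g (x + v) - g x) g' 0 :=
    ((hasFDerivAt_comp_add_left x).2 (by rwa [add_zero])).sub_const (g x)
  have h_tendsto : Filter.Tendsto (fun v => g (x + v) - g x) (𝓝 0) (𝓝 0) := by
    simpa using h_shift.continuousAt.tendsto
  have h_chart : (fun v => coords (F (proj x + proj v) - F (proj x)))
      =ᶠ[𝓝 0] fun v => g (x + v) - g x := by
    filter_upwards [h_tendsto.eventually eventually_coords_proj] with v hv
    rw [← proj_add, hF, hF, ← proj_sub, hv]
  exact (h_shift.congr_of_eventuallyEq h_chart).fderiv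

theorem hasDerivWithinAt_coords {c : ℝ → Torus} {g : ℝ → ℝ × ℝ} {s : Set ℝ} {t : ℝ} {v : ℝ × ℝ}
    (hg : HasDerivWithinAt g v s t) (hc : ∀ r ∈ s, c r = proj (g r)) (ht : t ∈ s) :
    HasDerivWithinAt (fun r => coords (c r - c t)) v s t := by
  have h_tendsto : Filter.Tendsto (fun r => g r - g t) (𝓝[s] t) (𝓝 0) := by
    simpa using hg.continuousWithinAt.tendsto.sub_const (g t)
  refine (hg.sub_const (g t)).congr_of_eventuallyEq ?_ (by simp [coords_zero])
  filter_upwards [h_tendsto.eventually eventually_coords_proj, self_mem_nhdsWithin] with r hr hrs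
  rw [hc r hrs, hc t ht, ← proj_sub, hr]

theorem eq_proj_of_hasDerivAt_coords {c : ℝ → Torus} {g v : ℝ → ℝ × ℝ}
    (hc : ∀ t, HasDerivAt (fun r => coords (c r - c t)) (v t) t)
    (hg : ∀ t, HasDerivAt g (v t) t) {a : ℝ} (h₀ : c a = proj (g a)) (t : ℝ) :
    c t = proj (g t) := by
  set d : ℝ → Torus := fun r => c r - proj (g r) with hd
  have hasDerivAt_norm (t : ℝ) : HasDerivAt (fun r => ‖d r‖) 0 t := by
    refine hasDerivAt_iff_isLittleO.2 (Asymptotics.IsBigO.trans_isLittleO (.of_bound' ?_)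
      ((hc t).sub (hg t)).isLittleO)
    refine .of_forall fun r => ?_
    have h_diff : d r - d t = proj (coords (c r - c t) - (g r - g t)) := by
      rw [proj_sub, proj_coords, proj_sub]
      exact sub_sub_sub_comm _ _ _ _
    have h_norm : ‖‖d r‖ - ‖d t‖‖ ≤ ‖coords (c r - c t) - (g r - g t)‖ :=
      (abs_norm_sub_norm_le _ _).trans (h_diff ▸ norm_proj_le _)
    simpa [coords_zero, sub_sub_sub_comm, sub_sub, sub_add] using h_norm
  have h_const : ‖d t‖ = ‖d a‖ := is_const_of_deriv_eq_zero
    (fun t => (hasDerivAt_norm t).differentiableAt) (fun t => (hasDerivAt_norm t).deriv) t a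
  rwa [show d a = 0 from sub_eq_zero.2 h₀, norm_zero, norm_eq_zero, hd, sub_eq_zero] at h_const

/-! ### The lift of an isotopy to `ℝ²` -/

namespace SymplecticIsotopy

variable {Φ : SymplecticIsotopy} {L : ℝ × (ℝ × ℝ) → ℝ × ℝ} {t : ℝ}

/-- `L` is the lift of the isotopy `Φ` to the universal covering that starts at the identity. As
for isotopies, only its values at times `t ∈ [0, 1]` matter. -/
structure IsLift (Φ : SymplecticIsotopy) (L : ℝ × (ℝ × ℝ) → ℝ × ℝ) : Prop where
  contDiffOn : ContDiffOn ℝ ∞ L (strip 0 1 (ℝ × ℝ))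
  proj_apply : ∀ t ∈ Set.Icc (0 : ℝ) 1, ∀ x, proj (L (t, x)) = Φ.map t (proj x)
  apply_zero : ∀ x, L (0, x) = x

theorem continuous_map (Φ : SymplecticIsotopy) :
    Continuous fun z : unitInterval × (ℝ × ℝ) => Φ.map z.1 (proj z.2) := by
  have h_strip : ContinuousOn (fun z : ℝ × (ℝ × ℝ) => Φ.map z.1 (proj z.2))
      (strip 0 1 (ℝ × ℝ)) := by
    intro z hz
    obtain ⟨U, hU, hzU, g, hg, hgF⟩ := Φ.smooth z hz
    have h_inter : ContinuousOn (fun z : ℝ × (ℝ × ℝ) => Φ.map z.1 (proj z.2))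
        (strip 0 1 (ℝ × ℝ) ∩ U) :=
      (isCoveringMap_proj.continuous.comp_continuousOn hg.continuousOn).congr fun y hy =>
        (hgF y hy).symm
    exact (h_inter z ⟨hz, hzU⟩).mono_of_mem_nhdsWithin
      (Filter.inter_mem self_mem_nhdsWithin (mem_nhdsWithin_of_mem_nhds (hU.mem_nhds hzU)))
  exact h_strip.comp_continuous (f := fun z : unitInterval × (ℝ × ℝ) => ((z.1 : ℝ), z.2))
    (by fun_prop) fun z => ⟨z.1.2, trivial⟩

theorem exists_isLift (Φ : SymplecticIsotopy) : ∃ L, Φ.IsLift L := by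
  let H : C(unitInterval × (ℝ × ℝ), Torus) := ⟨_, Φ.continuous_map⟩
  have H_zero (x : ℝ × ℝ) : H (0, x) = proj (ContinuousMap.id _ x) := by simp [H, Φ.map_zero]
  let G := isCoveringMap_proj.liftHomotopy H (.id _) H_zero
  let L (z : ℝ × (ℝ × ℝ)) : ℝ × ℝ := G (Set.projIcc 0 1 zero_le_one z.1, z.2)
  have L_apply (t : unitInterval) (x : ℝ × ℝ) : L (t, x) = G (t, x) := by simp [L]
  have proj_L (t : ℝ) (ht : t ∈ Set.Icc (0 : ℝ) 1) (x : ℝ × ℝ) :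
      proj (L (t, x)) = Φ.map t (proj x) := by
    rw [L_apply ⟨t, ht⟩]
    exact congrFun (isCoveringMap_proj.liftHomotopy_lifts H (.id _) H_zero) (⟨t, ht⟩, x)
  refine ⟨L, contDiffOn_of_smoothIntoOn Φ.smooth ?_ fun z hz => proj_L z.1 hz.1 z.2, proj_L,
    fun x => ?_⟩
  · exact (by fun_prop : Continuous L).continuousOn
  · exact (L_apply 0 x).trans (isCoveringMap_proj.liftHomotopy_zero H (.id _) H_zero x)

namespace IsLift

theorem differentiableOn (hL : Φ.IsLift L) : DifferentiableOn ℝ L (strip 0 1 (ℝ × ℝ)) :=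
  hL.contDiffOn.differentiableOn (by simp)

theorem velocity_proj (hL : Φ.IsLift L) (ht : t ∈ Set.Icc (0 : ℝ) 1) (x : ℝ × ℝ) :
    Φ.velocity t (proj x) = fderivWithin ℝ L (strip 0 1 (ℝ × ℝ)) (t, x) (1, 0) :=
  (hasDerivWithinAt_coords (hasDerivWithinAt_time_slice hL.differentiableOn ht x)
    (fun s hs => (hL.proj_apply s hs x).symm) ht).derivWithin (uniqueDiffOn_Icc_zero_one t ht)

theorem tangentMap_proj (hL : Φ.IsLift L) (ht : t ∈ Set.Icc (0 : ℝ) 1) (x : ℝ × ℝ) :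
    tangentMap (Φ.map t) (proj x) =
      (fderivWithin ℝ L (strip 0 1 (ℝ × ℝ)) (t, x)).comp (.inr ℝ ℝ (ℝ × ℝ)) :=
  TorusFlux.tangentMap_proj (hasFDerivAt_space_slice hL.differentiableOn ht x)
    fun y => (hL.proj_apply t ht y).symm

theorem omega_fderivWithin (hL : Φ.IsLift L) (ht : t ∈ Set.Icc (0 : ℝ) 1) (x u v : ℝ × ℝ) :
    omega (fderivWithin ℝ L (strip 0 1 (ℝ × ℝ)) (t, x) (0, u))
      (fderivWithin ℝ L (strip 0 1 (ℝ × ℝ)) (t, x) (0, v)) = omega u v := by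
  simpa only [hL.tangentMap_proj ht, ContinuousLinearMap.comp_apply,
    ContinuousLinearMap.inr_apply] using Φ.symplectic t ht (proj x) u v

theorem fluxForm_proj (hL : Φ.IsLift L) (x : ℝ × ℝ) :
    Φ.fluxForm (proj x) = ∫ t in (0 : ℝ)..1,
      (omega (fderivWithin ℝ L (strip 0 1 (ℝ × ℝ)) (t, x) (1, 0))).comp
        ((fderivWithin ℝ L (strip 0 1 (ℝ × ℝ)) (t, x)).comp (.inr ℝ ℝ (ℝ × ℝ))) := by
  refine intervalIntegral.integral_congr fun t ht => ?_
  rw [Set.uIcc_of_le zero_le_one] at ht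
  simp only [pullback, contract, generator, Equiv.symm_apply_apply, hL.velocity_proj ht,
    hL.tangentMap_proj ht]

theorem apply_add_lattice (hL : Φ.IsLift L) (ht : t ∈ Set.Icc (0 : ℝ) 1) (x : ℝ × ℝ)
    (k : ℤ × ℤ) : L (t, x + lattice k) = L (t, x) + lattice k := by
  have L_continuous : Continuous fun z : unitInterval × (ℝ × ℝ) => L (z.1, z.2) :=
    hL.contDiffOn.continuousOn.comp_continuous
      (f := fun z : unitInterval × (ℝ × ℝ) => ((z.1 : ℝ), z.2)) (by fun_prop)
      fun z => ⟨z.1.2, trivial⟩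
  have L_shift_continuous :
      Continuous fun z : unitInterval × (ℝ × ℝ) => L (z.1, z.2 + lattice k) :=
    L_continuous.comp (continuous_fst.prodMk (continuous_snd.add_const (lattice k)))
  obtain ⟨m, hm⟩ := exists_eq_add_lattice_of_proj_eq L_shift_continuous L_continuous fun z => by
    rw [hL.proj_apply _ z.1.2, hL.proj_apply _ z.1.2, proj_add_lattice]
  have hkm : lattice k = lattice m := by simpa [hL.apply_zero] using hm (0, 0)
  rw [hm (⟨t, ht⟩, x), hkm]

theorem fderivWithin_time_add_lattice (hL : Φ.IsLift L) (ht : t ∈ Set.Icc (0 : ℝ) 1) (x : ℝ × ℝ)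
    (k : ℤ × ℤ) : fderivWithin ℝ L (strip 0 1 (ℝ × ℝ)) (t, x + lattice k) (1, 0) =
      fderivWithin ℝ L (strip 0 1 (ℝ × ℝ)) (t, x) (1, 0) := by
  rw [← hL.velocity_proj ht, proj_add_lattice, hL.velocity_proj ht]

theorem exists_apply_one_eq_add (hL : Φ.IsLift L) (hΦ : Φ.IsLoop) :
    ∃ k, ∀ x, L (1, x) = x + lattice k :=
  exists_eq_add_lattice_of_proj_eq
    (contDiff_space_slice hL.contDiffOn unitInterval.one_mem).continuous continuous_id
    fun x => by rw [hL.proj_apply 1 unitInterval.one_mem, hΦ, Equiv.refl_apply]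

end IsLift

end SymplecticIsotopy

/-! ### The flux form is a coboundary up to the Liouville form -/

theorem omega_swap (u v : ℝ × ℝ) : omega u v = -omega v u := by
  simp only [omega_apply]
  ring

section Liouville

variable {E : Type*} [NormedAddCommGroup E] [NormedSpace ℝ E] {g : E → ℝ × ℝ} {S : Set E} {z : E}

/-- The pullback `g^* λ`, on the domain `S`, of the Liouville form `λ = (x dy - y dx) / 2`, the
primitive of `omega` on the plane. -/
def liouville (g : E → ℝ × ℝ) (S : Set E) (z : E) : E →L[ℝ] ℝ :=
  (1 / 2 : ℝ) • (omega (g z)).comp (fderivWithin ℝ g S z)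

theorem liouville_apply (u : E) :
    liouville g S z u = 1 / 2 * omega (g z) (fderivWithin ℝ g S z u) := rfl

theorem contDiffOn_liouville (hg : ContDiffOn ℝ ∞ g S) (hS : UniqueDiffOn ℝ S) :
    ContDiffOn ℝ ∞ (liouville g S) S :=
  ((omega.contDiff.comp_contDiffOn hg).clm_comp (hg.fderivWithin hS (by simp))).const_smul _

theorem fderivWithin_liouville_apply (hg : ContDiffOn ℝ ∞ g S) (hS : UniqueDiffOn ℝ S) (hz : z ∈ S)
    (u v : E) : fderivWithin ℝ (liouville g S) S z u v =
      1 / 2 * (omega (fderivWithin ℝ g S z u) (fderivWithin ℝ g S z v) +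
        omega (g z) (fderivWithin ℝ (fderivWithin ℝ g S) S z u v)) := by
  have hg' : HasFDerivWithinAt g (fderivWithin ℝ g S z) S z :=
    (hg.differentiableOn (by simp) z hz).hasFDerivWithinAt
  have hg'' : HasFDerivWithinAt (fderivWithin ℝ g S)
      (fderivWithin ℝ (fderivWithin ℝ g S) S z) S z :=
    ((hg.fderivWithin (m := ∞) hS (by simp)).differentiableOn
      (by simp) z hz).hasFDerivWithinAt
  have h_liouville : HasFDerivWithinAt (liouville g S) _ S z :=
    ((omega.hasFDerivAt.comp_hasFDerivWithinAt z hg').clm_comp hg'').const_smul (1 / 2 : ℝ)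
  rw [h_liouville.fderivWithin (hS z hz)]
  simp only [Function.comp_apply, smul_add, add_apply, smul_apply, smul_eq_mul,
    ContinuousLinearMap.comp_apply, ContinuousLinearMap.compL_apply,
    ContinuousLinearMap.flip_apply]
  ring

/-- Cartan's formula `d (g^* λ) = g^* ω`. -/
theorem fderivWithin_liouville_sub (hg : ContDiffOn ℝ ∞ g S) (hS : UniqueDiffOn ℝ S) (hz : z ∈ S)
    (hz' : z ∈ closure (interior S)) (u v : E) :
    fderivWithin ℝ (liouville g S) S z u v - fderivWithin ℝ (liouville g S) S z v u =
      omega (fderivWithin ℝ g S z u) (fderivWithin ℝ g S z v) := by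
  have h_symm : IsSymmSndFDerivWithinAt ℝ g S z :=
    (hg z hz).isSymmSndFDerivWithinAt (by simpa using ENat.LEInfty.out) hS hz' hz
  rw [fderivWithin_liouville_apply hg hS hz, fderivWithin_liouville_apply hg hS hz, h_symm u v,
    omega_swap (fderivWithin ℝ g S z v)]
  ring

theorem contDiff_liouville (hg : ContDiff ℝ ∞ g) : ContDiff ℝ ∞ (liouville g Set.univ) :=
  contDiffOn_univ.1 (contDiffOn_liouville hg.contDiffOn uniqueDiffOn_univ)

theorem fderiv_liouville_sub (hg : ContDiff ℝ ∞ g) (z u v : E) :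
    fderiv ℝ (liouville g Set.univ) z u v - fderiv ℝ (liouville g Set.univ) z v u =
      omega (fderiv ℝ g z u) (fderiv ℝ g z v) := by
  simpa only [fderivWithin_univ] using
    fderivWithin_liouville_sub hg.contDiffOn uniqueDiffOn_univ (Set.mem_univ z) (by simp) u v

end Liouville

section Homotopy

variable {E : Type*} [NormedAddCommGroup E] [NormedSpace ℝ E] [FiniteDimensional ℝ E]
  {a b : ℝ} {β : ℝ × E → ℝ × E →L[ℝ] ℝ}

/-- The homotopy formula: integrating `d β` over the fibres of `[a, b] × E → E` gives the
difference of the restrictions of `β` to the ends minus an exact form. -/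
theorem integral_fderivWithin_sub_eq (hab : a < b) (hβ : ContDiffOn ℝ 1 β (strip a b E)) (x u : E) :
    ∫ t in a..b, (fderivWithin ℝ β (strip a b E) (t, x) (1, 0) (0, u) -
        fderivWithin ℝ β (strip a b E) (t, x) (0, u) (1, 0)) =
      β (b, x) (0, u) - β (a, x) (0, u) -
        fderiv ℝ (fun y => ∫ t in a..b, β (t, y) (1, 0)) x u := by
  have hβ_apply (w : ℝ × E) : ContDiffOn ℝ 1 (fun z => β z w) (strip a b E) :=
    hβ.clm_apply contDiffOn_const
  have hβ_cont (v w : ℝ × E) :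
      ContinuousOn (fun z => fderivWithin ℝ β (strip a b E) z v w) (strip a b E) :=
    ((hβ.continuousOn_fderivWithin (uniqueDiffOn_strip hab) le_rfl).clm_apply
      continuousOn_const).clm_apply continuousOn_const
  have fderivWithin_apply {t : ℝ} (ht : t ∈ Set.Icc a b) (v w : ℝ × E) :
      fderivWithin ℝ (fun z => β z w) (strip a b E) (t, x) v =
        fderivWithin ℝ β (strip a b E) (t, x) v w := by
    have hz : (t, x) ∈ strip a b E := ⟨ht, trivial⟩
    rw [fderivWithin_clm_apply (uniqueDiffOn_strip hab _ hz) (hβ.differentiableOn one_ne_zero _ hz)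
      (differentiableWithinAt_const w)]
    simp
  have h_time : ∫ t in a..b, fderivWithin ℝ β (strip a b E) (t, x) (1, 0) (0, u) =
      β (b, x) (0, u) - β (a, x) (0, u) := by
    rw [← integral_fderivWithin_time hab (hβ_apply (0, u))]
    refine intervalIntegral.integral_congr fun t ht => ?_
    exact (fderivWithin_apply (Set.uIcc_of_le hab.le ▸ ht) _ _).symm
  have h_space : ∫ t in a..b, fderivWithin ℝ β (strip a b E) (t, x) (0, u) (1, 0) =
      fderiv ℝ (fun y => ∫ t in a..b, β (t, y) (1, 0)) x u := by
    have h_cont := ((hβ_apply (1, 0)).continuousOn_fderivWithin (uniqueDiffOn_strip hab)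
      le_rfl).clm_comp (continuousOn_const (c := ContinuousLinearMap.inr ℝ ℝ E))
    rw [(hasFDerivAt_integral_of_contDiffOn_strip hab (hβ_apply (1, 0)) x).fderiv,
      ContinuousLinearMap.intervalIntegral_apply
        (intervalIntegrable_time_slice h_cont hab.le x)]
    refine intervalIntegral.integral_congr fun t ht => ?_
    exact (fderivWithin_apply (Set.uIcc_of_le hab.le ▸ ht) _ _).symm
  rw [intervalIntegral.integral_sub (intervalIntegrable_time_slice (hβ_cont _ _) hab.le x)
    (intervalIntegrable_time_slice (hβ_cont _ _) hab.le x), h_time, h_space]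

end Homotopy

namespace SymplecticIsotopy

variable {Φ : SymplecticIsotopy} {L : ℝ × (ℝ × ℝ) → ℝ × ℝ} {t : ℝ}

/-- The action of the trajectories of a lift: the integral of the Liouville form along
`t ↦ L (t, x)`, as a function of the starting point `x`. -/
def action (L : ℝ × (ℝ × ℝ) → ℝ × ℝ) (x : ℝ × ℝ) : ℝ :=
  ∫ t in (0 : ℝ)..1, liouville L (strip 0 1 (ℝ × ℝ)) (t, x) (1, 0)

namespace IsLift

theorem contDiffOn_liouville (hL : Φ.IsLift L) :
    ContDiffOn ℝ ∞ (liouville L (strip 0 1 (ℝ × ℝ))) (strip 0 1 (ℝ × ℝ)) :=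
  TorusFlux.contDiffOn_liouville hL.contDiffOn (uniqueDiffOn_strip zero_lt_one)

theorem liouville_inr (hL : Φ.IsLift L) (ht : t ∈ Set.Icc (0 : ℝ) 1) (x u : ℝ × ℝ) :
    liouville L (strip 0 1 (ℝ × ℝ)) (t, x) (0, u) =
      liouville (fun y => L (t, y)) Set.univ x u := by
  rw [liouville_apply, liouville_apply, fderivWithin_univ,
    (hasFDerivAt_space_slice hL.differentiableOn ht x).fderiv]
  rfl

theorem contDiff_action (hL : Φ.IsLift L) : ContDiff ℝ ∞ (action L) :=
  contDiff_integral_of_contDiffOn_strip zero_lt_one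
    (hL.contDiffOn_liouville.clm_apply contDiffOn_const)

theorem fluxForm_proj_eq (hL : Φ.IsLift L) (x : ℝ × ℝ) :
    Φ.fluxForm (proj x) = liouville (fun y => L (1, y)) Set.univ x - liouville id Set.univ x -
      fderiv ℝ (action L) x := by
  refine ContinuousLinearMap.ext fun u => ?_
  have h_cont : ContinuousOn (fun z =>
      (omega (fderivWithin ℝ L (strip 0 1 (ℝ × ℝ)) z (1, 0))).comp
        ((fderivWithin ℝ L (strip 0 1 (ℝ × ℝ)) z).comp (.inr ℝ ℝ (ℝ × ℝ))))
      (strip 0 1 (ℝ × ℝ)) := by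
    have h_fderiv := hL.contDiffOn.continuousOn_fderivWithin
      (uniqueDiffOn_strip zero_lt_one) (by simp)
    exact (omega.continuous.comp_continuousOn
      (h_fderiv.clm_apply continuousOn_const)).clm_comp (h_fderiv.clm_comp continuousOn_const)
  have h_cartan : ∀ t ∈ Set.uIcc (0 : ℝ) 1,
      omega (fderivWithin ℝ L (strip 0 1 (ℝ × ℝ)) (t, x) (1, 0))
        (fderivWithin ℝ L (strip 0 1 (ℝ × ℝ)) (t, x) (0, u)) = _ := fun t ht =>
    have hz : (t, x) ∈ strip 0 1 (ℝ × ℝ) := ⟨Set.uIcc_of_le (zero_le_one (α := ℝ)) ▸ ht, trivial⟩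
    (fderivWithin_liouville_sub hL.contDiffOn (uniqueDiffOn_strip zero_lt_one) hz
      (strip_subset_closure_interior zero_lt_one hz) (1, 0) (0, u)).symm
  have h_zero : (fun y => L (0, y)) = id := funext hL.apply_zero
  rw [hL.fluxForm_proj, ContinuousLinearMap.intervalIntegral_apply
    (intervalIntegrable_time_slice h_cont zero_le_one x)]
  refine (intervalIntegral.integral_congr h_cartan).trans ?_
  rw [integral_fderivWithin_sub_eq zero_lt_one (hL.contDiffOn_liouville.of_le (by simp)),
    hL.liouville_inr unitInterval.one_mem, hL.liouville_inr unitInterval.zero_mem, h_zero]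
  rfl

theorem contDiff_apply_one (hL : Φ.IsLift L) : ContDiff ℝ ∞ fun y => L (1, y) :=
  contDiff_space_slice hL.contDiffOn unitInterval.one_mem

theorem omega_fderiv_apply_one (hL : Φ.IsLift L) (x u v : ℝ × ℝ) :
    omega (fderiv ℝ (fun y => L (1, y)) x u) (fderiv ℝ (fun y => L (1, y)) x v) = omega u v := by
  rw [(hasFDerivAt_space_slice hL.differentiableOn unitInterval.one_mem x).fderiv]
  exact hL.omega_fderivWithin unitInterval.one_mem x u v

theorem fluxForm_mem_closedForms (hL : Φ.IsLift L) : Φ.fluxForm ∈ closedForms := by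
  have h_fluxForm : (fun x => Φ.fluxForm (proj x)) =
      liouville (fun y => L (1, y)) Set.univ - liouville id Set.univ - fderiv ℝ (action L) :=
    funext hL.fluxForm_proj_eq
  have h_one := contDiff_liouville hL.contDiff_apply_one
  have h_id := contDiff_liouville (contDiff_id (𝕜 := ℝ) (E := ℝ × ℝ) (n := ∞))
  have h_action := hL.contDiff_action.fderiv_right (m := ∞) (by simp)
  refine ⟨?_, fun x u v => ?_⟩
  · change ContDiff ℝ ∞ fun x => Φ.fluxForm (proj x)
    rw [h_fluxForm]
    exact (h_one.sub h_id).sub h_action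
  · have h_symm := hL.contDiff_action.contDiffAt.isSymmSndFDerivAt (x := x)
      (by simpa using ENat.LEInfty.out) u v
    have h_cartan_one := fderiv_liouville_sub hL.contDiff_apply_one x u v
    have h_cartan_id := fderiv_liouville_sub contDiff_id x u v
    rw [hL.omega_fderiv_apply_one] at h_cartan_one
    rw [fderiv_id, ContinuousLinearMap.id_apply, ContinuousLinearMap.id_apply] at h_cartan_id
    have h_diff {f : ℝ × ℝ → ℝ × ℝ →L[ℝ] ℝ} (hf : ContDiff ℝ ∞ f) : DifferentiableAt ℝ f x :=
      hf.differentiable (by simp) x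
    rw [formDeriv, h_fluxForm, fderiv_sub ((h_diff h_one).sub (h_diff h_id)) (h_diff h_action),
      fderiv_sub (h_diff h_one) (h_diff h_id)]
    simp only [sub_apply]
    linarith

end IsLift

end SymplecticIsotopy

/-! ### First cohomology through periods -/

/-- The one-form with constant coefficients `M`. -/
def constForm (M : ℝ × ℝ →L[ℝ] ℝ) : OneForm := fun _ => M

theorem formDeriv_constForm (M : ℝ × ℝ →L[ℝ] ℝ) (x : ℝ × ℝ) : formDeriv (constForm M) x = 0 :=
  fderiv_const_apply M

theorem constForm_mem_closedForms (M : ℝ × ℝ →L[ℝ] ℝ) : constForm M ∈ closedForms :=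
  ⟨contDiff_const, fun x u v => by simp [formDeriv_constForm]⟩

/-- The cohomology class of a one-form with constant coefficients. -/
def constClass (M : ℝ × ℝ →L[ℝ] ℝ) : H1 :=
  deRhamClass (constForm M) (constForm_mem_closedForms M)

theorem deRhamClass_eq_iff {α β : OneForm} {hα : α ∈ closedForms} {hβ : β ∈ closedForms} :
    deRhamClass α hα = deRhamClass β hβ ↔ α - β ∈ exactForms :=
  Submodule.Quotient.eq _

theorem eq_of_apply_lattice_eq {M N : ℝ × ℝ →L[ℝ] ℝ}
    (h : ∀ k, M (lattice k) = N (lattice k)) : M = N := by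
  have h₁ := h (1, 0)
  have h₂ := h (0, 1)
  simp only [lattice, Int.cast_one, Int.cast_zero] at h₁ h₂
  exact ContinuousLinearMap.prod_ext (ContinuousLinearMap.ext_ring (by simpa using h₁))
    (ContinuousLinearMap.ext_ring (by simpa using h₂))

theorem eq_of_hasFDerivAt_zero {E F : Type*} [NormedAddCommGroup E] [NormedSpace ℝ E]
    [NormedAddCommGroup F] [NormedSpace ℝ F] {g : E → F}
    (h : ∀ x, HasFDerivAt g (0 : E →L[ℝ] F) x) (x y : E) : g x = g y :=
  is_const_of_fderiv_eq_zero (𝕜 := ℝ) (fun x => (h x).differentiableAt) (fun x => (h x).fderiv)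
    x y

theorem constClass_injective : Function.Injective constClass := by
  intro M N h
  obtain ⟨f, hf, hf'⟩ := deRhamClass_eq_iff.1 h
  have h_deriv (x : ℝ × ℝ) :
      HasFDerivAt (fun y => f (proj y) - (M - N) y) (0 : ℝ × ℝ →L[ℝ] ℝ) x := by
    have := (hf.differentiable (by simp) x).hasFDerivAt.sub (M - N).hasFDerivAt
    rwa [← hf', show (constForm M - constForm N) (proj x) = M - N from rfl, sub_self] at this
  refine eq_of_apply_lattice_eq fun k => ?_
  have h_const := eq_of_hasFDerivAt_zero h_deriv (lattice k) 0
  simpa [proj_lattice, proj_zero, sub_eq_zero] using h_const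

theorem exists_smoothFun_comp_proj {F : Type*} [NormedAddCommGroup F] [NormedSpace ℝ F]
    {g : ℝ × ℝ → F} (hg : ContDiff ℝ ∞ g) (h : ∀ x k, g (x + lattice k) = g x) :
    ∃ f : Torus → F, SmoothFun f ∧ ∀ x, f (proj x) = g x := by
  have h_proj (x : ℝ × ℝ) : g (coords (proj x)) = g x := by
    obtain ⟨k, hk⟩ := proj_eq_zero_iff.1 <|
      show proj (coords (proj x) - x) = 0 by rw [proj_sub, proj_coords, sub_self]
    rw [← h x k, hk, add_sub_cancel]
  exact ⟨fun q => g (coords q), by simpa only [SmoothFun, h_proj] using hg, h_proj⟩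

variable {α : OneForm} {f : ℝ × ℝ → ℝ}

theorem contDiff_of_hasFDerivAt (hα : SmoothFun α) (hf : ∀ x, HasFDerivAt f (α (proj x)) x) :
    ContDiff ℝ ∞ f :=
  contDiff_infty_iff_fderiv.2 ⟨fun x => (hf x).differentiableAt,
    (funext fun x => (hf x).fderiv : fderiv ℝ f = _) ▸ hα⟩

theorem deRhamClass_eq_constClass_of_periods (hα : α ∈ closedForms)
    (hf : ∀ x, HasFDerivAt f (α (proj x)) x) {M : ℝ × ℝ →L[ℝ] ℝ}
    (h_period : ∀ x k, f (x + lattice k) = f x + M (lattice k)) :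
    deRhamClass α hα = constClass M := by
  obtain ⟨g, hg, hgf⟩ := exists_smoothFun_comp_proj (g := fun x => f x - M x)
    ((contDiff_of_hasFDerivAt hα.1 hf).sub M.contDiff)
    fun x k => by rw [h_period, map_add]; abel
  refine deRhamClass_eq_iff.2 ⟨g, hg, fun x => ?_⟩
  rw [funext hgf]
  exact ((hf x).sub M.hasFDerivAt).fderiv.symm

theorem exists_hasFDerivAt (hα : α ∈ closedForms) :
    ∃ f : ℝ × ℝ → ℝ, ∀ x, HasFDerivAt f (α (proj x)) x := by
  obtain ⟨f, hf⟩ := convex_univ.exists_forall_hasFDerivAt_of_fderiv_symmetric isOpen_univ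
    (hα.1.differentiable (by simp)).differentiableOn
    fun x _ u v => sub_eq_zero.1 (hα.2 x u v)
  exact ⟨f, fun x => hf x trivial⟩

theorem exists_periods (hf : ∀ x, HasFDerivAt f (α (proj x)) x) :
    ∃ M : ℝ × ℝ →L[ℝ] ℝ, ∀ x k, f (x + lattice k) = f x + M (lattice k) := by
  have h_deriv (k : ℤ × ℤ) (x : ℝ × ℝ) :
      HasFDerivAt (fun y => f (y + lattice k) - f y) (0 : ℝ × ℝ →L[ℝ] ℝ) x := by
    have := ((hasFDerivAt_comp_add_right (lattice k)).2 (hf (x + lattice k))).sub (hf x)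
    rwa [proj_add_lattice, sub_self] at this
  have h_const (k : ℤ × ℤ) (x : ℝ × ℝ) : f (x + lattice k) - f x = f (lattice k) - f 0 := by
    simpa using eq_of_hasFDerivAt_zero (h_deriv k) x 0
  have lattice_add (k l : ℤ × ℤ) : lattice (k + l) = lattice k + lattice l := by
    simp [lattice]
  let period : ℤ × ℤ →+ ℝ := AddMonoidHom.mk' (fun k => f (lattice k) - f 0) fun k l => by
    rw [lattice_add]
    linarith [h_const l (lattice k)]
  refine ⟨(ContinuousLinearMap.fst ℝ ℝ ℝ).smulRight (period (1, 0)) +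
    (ContinuousLinearMap.snd ℝ ℝ ℝ).smulRight (period (0, 1)), fun x k => ?_⟩
  have h_gen : period k = k.1 * period (1, 0) + k.2 * period (0, 1) := by
    rw [← zsmul_eq_mul, ← zsmul_eq_mul, ← map_zsmul, ← map_zsmul, ← map_add]
    simp
  have h_period : period k = f (x + lattice k) - f x := (h_const k x).symm
  simp [lattice, ← h_gen, h_period]

theorem constClass_surjective : Function.Surjective constClass := by
  intro c
  obtain ⟨⟨α, hα⟩, rfl⟩ := Submodule.Quotient.mk_surjective _ c
  obtain ⟨f, hf⟩ := exists_hasFDerivAt hα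
  obtain ⟨M, hM⟩ := exists_periods hf
  exact ⟨M, (deRhamClass_eq_constClass_of_periods hα hf hM).symm⟩

theorem omega_bijective : Function.Bijective omega := by
  constructor
  · intro u v h
    have h₁ := DFunLike.congr_fun h (0, 1)
    have h₂ := DFunLike.congr_fun h (1, 0)
    simp only [omega_apply] at h₁ h₂
    exact Prod.ext (by linarith) (by linarith)
  · intro M
    refine ⟨(M (0, 1), -M (1, 0)), ContinuousLinearMap.ext fun v => ?_⟩
    have h_basis : v = v.1 • (1, 0) + v.2 • (0, 1) := by ext <;> simp
    rw [omega_apply, h_basis, map_add, map_smul, map_smul]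
    simp only [smul_eq_mul, Prod.smul_mk, Prod.mk_add_mk, mul_one, mul_zero, add_zero, zero_add]
    ring

theorem integralClass_apply (k : ℤ × ℤ) :
    integralClass k = constClass (omega (lattice (k.2, -k.1))) := by
  change k.1 • deRhamClass dx dx_mem + k.2 • deRhamClass dy dy_mem = _
  rw [← Int.cast_smul_eq_zsmul ℝ, ← Int.cast_smul_eq_zsmul ℝ]
  refine congrArg Submodule.Quotient.mk
    (Subtype.ext (funext fun q => ContinuousLinearMap.ext fun v => ?_))
  change (k.1 : ℝ) * v.1 + (k.2 : ℝ) * v.2 = omega (lattice (k.2, -k.1)) v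
  rw [omega_apply, lattice, Int.cast_neg]
  ring

/-! ### The flux group -/

namespace SymplecticIsotopy

variable {Φ : SymplecticIsotopy} {L : ℝ × (ℝ × ℝ) → ℝ × ℝ} {c : ℝ × ℝ}

theorem fluxForm_mem_closedForms (Φ : SymplecticIsotopy) : Φ.fluxForm ∈ closedForms :=
  Φ.exists_isLift.elim fun _ hL => hL.fluxForm_mem_closedForms

theorem flux_eq_deRhamClass (Φ : SymplecticIsotopy) :
    Φ.flux = deRhamClass Φ.fluxForm Φ.fluxForm_mem_closedForms :=
  dif_pos _

namespace IsLift

theorem action_add_lattice (hL : Φ.IsLift L) (x : ℝ × ℝ) (k : ℤ × ℤ) :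
    action L (x + lattice k) = action L x + 1 / 2 * omega (lattice k) (L (1, x) - x) := by
  have h_time : ContinuousOn (fun z => fderivWithin ℝ L (strip 0 1 (ℝ × ℝ)) z (1, 0))
      (strip 0 1 (ℝ × ℝ)) :=
    (hL.contDiffOn.continuousOn_fderivWithin (uniqueDiffOn_strip zero_lt_one) (by simp)).clm_apply
      continuousOn_const
  have h_time_int := intervalIntegrable_time_slice h_time zero_le_one x
  have h_omega_int := intervalIntegrable_time_slice
    ((omega (lattice k)).continuous.comp_continuousOn' h_time) zero_le_one x
  have h_liouville_int := intervalIntegrable_time_slice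
    (hL.contDiffOn_liouville.continuousOn.clm_apply (continuousOn_const (c := (1, 0))))
    zero_le_one x
  have h_shift : ∀ t ∈ Set.uIcc (0 : ℝ) 1,
      liouville L (strip 0 1 (ℝ × ℝ)) (t, x + lattice k) (1, 0) =
        liouville L (strip 0 1 (ℝ × ℝ)) (t, x) (1, 0) +
          1 / 2 * omega (lattice k) (fderivWithin ℝ L (strip 0 1 (ℝ × ℝ)) (t, x) (1, 0)) := by
    intro t ht
    rw [Set.uIcc_of_le zero_le_one] at ht
    rw [liouville_apply, hL.apply_add_lattice ht, hL.fderivWithin_time_add_lattice ht, map_add,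
      add_apply, mul_add, liouville_apply]
  rw [action, intervalIntegral.integral_congr h_shift,
    intervalIntegral.integral_add h_liouville_int (h_omega_int.const_mul (1 / 2)),
    intervalIntegral.integral_const_mul,
    ContinuousLinearMap.intervalIntegral_comp_comm _ h_time_int,
    integral_fderivWithin_time zero_lt_one (hL.contDiffOn.of_le (by simp)), hL.apply_zero, action]

theorem hasFDerivAt_primitive (hL : Φ.IsLift L) (h : ∀ x, L (1, x) = x + c) (x : ℝ × ℝ) :
    HasFDerivAt (fun y => 1 / 2 * omega c y - action L y) (Φ.fluxForm (proj x)) x := by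
  have h_action : HasFDerivAt (action L) _ x :=
    (hL.contDiff_action.differentiable (by simp) x).hasFDerivAt
  have h_omega : HasFDerivAt (fun y => 1 / 2 * omega c y) ((1 / 2 : ℝ) • omega c) x :=
    (omega c).hasFDerivAt.const_mul (1 / 2)
  refine (h_omega.sub h_action).congr_fderiv ?_
  refine ContinuousLinearMap.ext fun u => ?_
  simp only [hL.fluxForm_proj_eq, liouville_apply, h, sub_apply, smul_apply, smul_eq_mul, map_add,
    add_apply, fderivWithin_univ, fderiv_add_const, fderiv_fun_id, fderiv_id, id_eq,
    ContinuousLinearMap.id_apply]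
  ring

theorem flux_eq_constClass (hL : Φ.IsLift L) (h : ∀ x, L (1, x) = x + c) :
    Φ.flux = constClass (omega c) := by
  rw [flux_eq_deRhamClass]
  refine deRhamClass_eq_constClass_of_periods _ (hL.hasFDerivAt_primitive h) fun x k => ?_
  rw [hL.action_add_lattice, h, add_sub_cancel_left, map_add, omega_swap (lattice k)]
  ring

end IsLift

theorem exists_flux_eq_of_isLoop (hΦ : Φ.IsLoop) :
    ∃ k, Φ.flux = constClass (omega (lattice k)) := by
  obtain ⟨L, hL⟩ := Φ.exists_isLift
  obtain ⟨k, hk⟩ := hL.exists_apply_one_eq_add hΦ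
  exact ⟨k, hL.flux_eq_constClass hk⟩

theorem tangentMap_addRight (v : ℝ × ℝ) (p : Torus) :
    tangentMap (Equiv.addRight (proj v)) p = .id ℝ (ℝ × ℝ) := by
  obtain ⟨x, rfl⟩ := proj_surjective p
  exact TorusFlux.tangentMap_proj ((hasFDerivAt_id x).add_const v) fun _ => rfl

/-- The isotopy of translations along the segment from `0` to `v`. -/
def translation (v : ℝ × ℝ) : SymplecticIsotopy where
  map t := Equiv.addRight (proj (t • v))
  smooth _ _ := ⟨Set.univ, isOpen_univ, trivial, fun z => z.2 + z.1 • v, by fun_prop,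
    fun _ _ => rfl⟩
  smooth_symm t _ _ _ := ⟨Set.univ, isOpen_univ, trivial, fun x => x - t • v, by fun_prop,
    fun x _ => by rw [proj_sub, sub_eq_add_neg]; rfl⟩
  symplectic t _ p u w := by
    rw [tangentMap_addRight, ContinuousLinearMap.id_apply, ContinuousLinearMap.id_apply]
  map_zero := by
    ext1 p
    simp [proj_zero]

theorem isLoop_translation (k : ℤ × ℤ) : (translation (lattice k)).IsLoop := by
  ext1 p
  simp [translation, proj_lattice]

theorem isLift_translation (v : ℝ × ℝ) :
    (translation v).IsLift fun z => z.2 + z.1 • v where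
  contDiffOn := by fun_prop
  proj_apply _ _ _ := rfl
  apply_zero x := by simp

theorem flux_translation (v : ℝ × ℝ) : (translation v).flux = constClass (omega v) :=
  (isLift_translation v).flux_eq_constClass fun x => by simp

end SymplecticIsotopy

theorem fluxGroup_eq_range :
    fluxGroup = Set.range fun k => constClass (omega (lattice k)) := by
  ext c
  constructor
  · rintro ⟨Φ, hΦ, rfl⟩
    obtain ⟨k, hk⟩ := Φ.exists_flux_eq_of_isLoop hΦ
    exact ⟨k, hk.symm⟩
  · rintro ⟨k, rfl⟩
    exact ⟨.translation (lattice k), SymplecticIsotopy.isLoop_translation k,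
      SymplecticIsotopy.flux_translation _⟩

theorem constClass_omega_injective : Function.Injective fun v => constClass (omega v) :=
  constClass_injective.comp omega_bijective.injective

theorem constClass_omega_mem_fluxGroup_iff {v : ℝ × ℝ} :
    constClass (omega v) ∈ fluxGroup ↔ proj v = 0 := by
  rw [fluxGroup_eq_range, proj_eq_zero_iff]
  exact exists_congr fun k => constClass_omega_injective.eq_iff

theorem integralClass_injective : Function.Injective integralClass := by
  intro k l h
  rw [integralClass_apply, integralClass_apply] at h
  have h_coord := lattice_injective (constClass_omega_injective h)
  rw [Prod.mk.injEq, neg_inj] at h_coord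
  exact Prod.ext h_coord.2 h_coord.1

theorem range_integralClass : Set.range integralClass = fluxGroup := by
  rw [fluxGroup_eq_range]
  ext c
  constructor
  · rintro ⟨k, rfl⟩
    exact ⟨(k.2, -k.1), (integralClass_apply k).symm⟩
  · rintro ⟨k, rfl⟩
    exact ⟨(-k.2, k.1), by rw [integralClass_apply, neg_neg]⟩

/-! ### Harmonic forms and fields -/

theorem isHarmonic_constForm (M : ℝ × ℝ →L[ℝ] ℝ) : IsHarmonic (constForm M) :=
  ⟨constForm_mem_closedForms M, fun x => by simp [codifferential, formDeriv_constForm]⟩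

theorem SmoothFun.continuous {F : Type*} [NormedAddCommGroup F] [NormedSpace ℝ F] {f : Torus → F}
    (hf : SmoothFun f) : Continuous f :=
  isQuotientMap_proj.continuous_iff.2 (ContDiff.continuous (𝕜 := ℝ) hf)

variable {α : OneForm}

/-- The periodic function `a - i b` on `ℂ` attached to the one-form `α = a dx + b dy`, which is the
real part of `(a - i b) dz`. -/
def complexCoeff (α : OneForm) (z : ℂ) : ℂ :=
  α (proj (z.re, z.im)) (1, 0) - Complex.I * α (proj (z.re, z.im)) (0, 1)

theorem complexCoeff_re (z : ℂ) : (complexCoeff α z).re = α (proj (z.re, z.im)) (1, 0) := by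
  simp [complexCoeff]

theorem complexCoeff_im (z : ℂ) : (complexCoeff α z).im = -α (proj (z.re, z.im)) (0, 1) := by
  simp [complexCoeff]

/-- Closedness and co-closedness are the Cauchy–Riemann equations of `a - i b`. -/
theorem IsHarmonic.differentiable_complexCoeff (hα : IsHarmonic α) :
    Differentiable ℂ (complexCoeff α) := by
  intro z
  have h_form : HasFDerivAt (fun z : ℂ => α (proj (z.re, z.im)))
      ((formDeriv α (z.re, z.im)).comp (Complex.reCLM.prod Complex.imCLM)) z :=
    HasFDerivAt.comp (g := fun x => α (proj x)) z
      (hα.1.1.differentiable (by simp) (z.re, z.im)).hasFDerivAt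
      (Complex.reCLM.prod Complex.imCLM).hasFDerivAt
  have h_coeff (u : ℝ × ℝ) := Complex.ofRealCLM.hasFDerivAt.comp z
    (h_form.clm_apply (hasFDerivAt_const u z))
  have h_complexCoeff : HasFDerivAt (complexCoeff α) _ z :=
    (h_coeff (1, 0)).sub ((h_coeff (0, 1)).const_mul Complex.I)
  have h_fderiv (w : ℂ) : fderiv ℝ (complexCoeff α) z w =
      formDeriv α (z.re, z.im) (w.re, w.im) (1, 0) -
        Complex.I * formDeriv α (z.re, z.im) (w.re, w.im) (0, 1) := by
    rw [h_complexCoeff.fderiv]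
    simp
  have h_closed := congrArg Complex.ofReal (hα.1.2 (z.re, z.im) (1, 0) (0, 1))
  have h_coclosed := congrArg Complex.ofReal (neg_eq_zero.1 (hα.2 (z.re, z.im)))
  push_cast at h_closed h_coclosed
  refine differentiableAt_complex_iff_differentiableAt_real.2
    ⟨h_complexCoeff.differentiableAt, ?_⟩
  simp only [h_fderiv, Complex.I_re, Complex.I_im, Complex.one_re, Complex.one_im, smul_eq_mul]
  linear_combination -h_closed - Complex.I * h_coclosed +
    (formDeriv α (z.re, z.im) (1, 0) (0, 1) : ℂ) * Complex.I_sq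

theorem isBounded_range_complexCoeff (hα : Continuous α) :
    Bornology.IsBounded (Set.range (complexCoeff α)) := by
  have h_apply (u : ℝ × ℝ) : Continuous fun p => (α p u : ℂ) :=
    Complex.continuous_ofReal.comp ((ContinuousLinearMap.apply ℝ ℝ u).continuous.comp hα)
  have h_coeff : Continuous fun p => (α p (1, 0) : ℂ) - Complex.I * α p (0, 1) :=
    (h_apply (1, 0)).sub (continuous_const.mul (h_apply (0, 1)))
  refine (isCompact_range h_coeff).isBounded.subset ?_
  rintro _ ⟨z, rfl⟩
  exact ⟨proj (z.re, z.im), rfl⟩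

theorem IsHarmonic.exists_eq_constForm (hα : IsHarmonic α) : ∃ M, α = constForm M := by
  refine ⟨α 0, funext fun p => ?_⟩
  obtain ⟨x, rfl⟩ := proj_surjective p
  have h_liouville : complexCoeff α ⟨x.1, x.2⟩ = complexCoeff α 0 :=
    hα.differentiable_complexCoeff.apply_eq_apply_of_bounded
      (isBounded_range_complexCoeff (SmoothFun.continuous hα.1.1)) _ _
  have h_re := congrArg Complex.re h_liouville
  have h_im := congrArg Complex.im h_liouville
  rw [complexCoeff_re, complexCoeff_re] at h_re
  rw [complexCoeff_im, complexCoeff_im, neg_inj] at h_im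
  exact ContinuousLinearMap.prod_ext (ContinuousLinearMap.ext_ring h_re)
    (ContinuousLinearMap.ext_ring h_im)

theorem isHarmonicRep_constClass_iff {M : ℝ × ℝ →L[ℝ] ℝ} :
    IsHarmonicRep α (constClass M) ↔ α = constForm M := by
  constructor
  · rintro ⟨hα, _, h_class⟩
    obtain ⟨N, rfl⟩ := hα.exists_eq_constForm
    rw [constClass_injective h_class]
  · rintro rfl
    exact ⟨isHarmonic_constForm M, constForm_mem_closedForms M, rfl⟩

theorem contract_eq_constForm_iff {A : VField} {v : ℝ × ℝ} :
    contract A = constForm (omega v) ↔ A = fun _ => v :=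
  ⟨fun h => funext fun p => omega_bijective.injective (congrFun h p), by rintro rfl; rfl⟩

/-! ### Flows of constant fields -/

theorem isFlow_const_iff {v : ℝ × ℝ} {ψ : ℝ → Torus → Torus} :
    IsFlow (fun _ => v) ψ ↔ ψ = fun t p => p + proj (t • v) := by
  have h_line (x : ℝ × ℝ) (t : ℝ) : HasDerivAt (fun s : ℝ => x + s • v) v t := by
    simpa using ((hasDerivAt_id t).smul_const v).const_add x
  constructor
  · rintro ⟨h_zero, h_deriv⟩
    funext t p
    obtain ⟨x, rfl⟩ := proj_surjective p
    exact eq_proj_of_hasDerivAt_coords (a := 0) (fun t => h_deriv t (proj x)) (h_line x)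
      (by simp [h_zero]) t
  · rintro rfl
    refine ⟨fun p => by simp [proj_zero], fun t p => ?_⟩
    obtain ⟨x, rfl⟩ := proj_surjective p
    exact hasDerivWithinAt_univ.1 <| hasDerivWithinAt_coords (h_line x t).hasDerivWithinAt
      (fun _ _ => rfl) trivial

theorem flow_one_eq_id_iff {v : ℝ × ℝ} {ψ : ℝ → Torus → Torus} (hψ : IsFlow (fun _ => v) ψ) :
    ψ 1 = id ↔ proj v = 0 := by
  obtain rfl := isFlow_const_iff.1 hψ
  simp [funext_iff]

end TorusFlux

end

open TorusFlux in
theorem mainTheorem10_general (Φ : SymplecticIsotopy) :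
    (Function.Injective integralClass ∧
      Set.range integralClass = fluxGroup) ∧
    Φ.fluxForm ∈ closedForms ∧
    (∃! α : OneForm, IsHarmonicRep α Φ.flux) ∧
    ∀ α : OneForm, IsHarmonicRep α Φ.flux →
      (∃! A : VField, IsHarmonicField A ∧ contract A = α) ∧
      ∀ A : VField, IsHarmonicField A → contract A = α →
        (∃ v : ℝ × ℝ, ∀ p, A p = v) ∧
        (∃! ψ : ℝ → Torus → Torus, IsFlow A ψ) ∧
        ∀ ψ : ℝ → Torus → Torus, IsFlow A ψ →
          (ψ 1 = id ↔ Φ.flux ∈ fluxGroup) := by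
  obtain ⟨v, hv⟩ : ∃ v, constClass (omega v) = Φ.flux :=
    constClass_surjective.comp omega_bijective.surjective Φ.flux
  refine ⟨⟨integralClass_injective, range_integralClass⟩,
    Φ.fluxForm_mem_closedForms, ?_⟩
  rw [← hv]
  simp only [isHarmonicRep_constClass_iff]
  refine ⟨existsUnique_eq, ?_⟩
  rintro α rfl
  constructor
  · exact ⟨fun _ => v, ⟨isHarmonic_constForm _, rfl⟩,
      fun A hA => contract_eq_constForm_iff.1 hA.2⟩
  · intro A _ hA
    obtain rfl := contract_eq_constForm_iff.1 hA
    refine ⟨⟨v, fun _ => rfl⟩, ?_, fun ψ hψ => ?_⟩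
    · simp only [isFlow_const_iff, existsUnique_eq]
    · rw [flow_one_eq_id_iff hψ, constClass_omega_mem_fluxGroup_iff]

theorem mainTheorem10 (Φ : TorusFlux.SymplecticIsotopy) (hΦ : Φ.IsLoop) :
    -- the flux group is the lattice of integral classes, a copy of `ℤ²`
    (Function.Injective TorusFlux.integralClass ∧
      Set.range TorusFlux.integralClass = TorusFlux.fluxGroup) ∧
    -- the flux form is closed, so that the flux of `Φ` is its cohomology class
    Φ.fluxForm ∈ TorusFlux.closedForms ∧
    -- the flux has exactly one harmonic representative
    (∃! α : TorusFlux.OneForm, TorusFlux.IsHarmonicRep α Φ.flux) ∧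
    ∀ α : TorusFlux.OneForm, TorusFlux.IsHarmonicRep α Φ.flux →
      -- which is the contraction of exactly one harmonic vector field
      (∃! A : TorusFlux.VField, TorusFlux.IsHarmonicField A ∧ TorusFlux.contract A = α) ∧
      ∀ A : TorusFlux.VField, TorusFlux.IsHarmonicField A → TorusFlux.contract A = α →
        -- this field is constant, and it has exactly one flow
        (∃ v : ℝ × ℝ, ∀ p, A p = v) ∧
        (∃! ψ : ℝ → TorusFlux.Torus → TorusFlux.Torus, TorusFlux.IsFlow A ψ) ∧
        ∀ ψ : ℝ → TorusFlux.Torus → TorusFlux.Torus, TorusFlux.IsFlow A ψ →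
          (ψ 1 = id ↔ Φ.flux ∈ TorusFlux.fluxGroup) :=
  mainTheorem10_general Φ
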